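/- Let $f:\mathbb{C}\to\mathbb{C}$ be a transcendental entire function, that is, an entire function that is not a polynomial. Write $f^n$ for the $n$-th iterate of $f$, let $M(r,f)=\max_{|z|=r}|f(z)|$ for $r\ge 0$, and let $M^n(r,f)$ be the $n$-th iterate of $r\mapsto M(r,f)$. Let $$A(f)=\{z\in\mathbb{C}: \text{there is } \ell\in\mathbb{N} \text{ such that } |f^{n+\ell}(z)|\ge M^n(R,f) \text{ for all } n\in\mathbb{N}\}$$ be the fast escaping set of $f$, where $R>0$ is any number with $M^n(R,f)\to\infty$ as $n\to\infty$ (the set does not depend on the choice of $R$), and let $$A'(f)=\{z\in A(f): \text{there is } N\in\mathbb{N} \text{ such that } |f^n(z)|=M(|f^{n-1}(z)|,f) \text{ for all } n\ge N\}$$ be the maximally fast escaping set; here $\mathbb{N}=\{1,2,\dots\}$. Let $\mathcal{M}(f)=\{z: |f(z)|=M(|z|,f)\}$. Then $A'(f)$ is contained in a countable union of curves, each of which is analytic except possibly at its endpoints; that is, each is the image of a continuous injective map $\gamma:[0,1]\to\mathbb{C}$ that is real analytic with $\gamma'\neq 0$ on $(0,1)$. Moreover, with $f^{-k}(S)$ denoting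 the preimage of $S$ under $f^k$ and $f^0$ the identity, $$A'(f)\subset\bigcup_{k=0}^{\infty} f^{-k}(\mathcal{M}(f)).$$ -/

import Mathlib

/-- `f` is an entire function that is not a polynomial. -/
def IsTranscendentalEntire (f : ℂ → ℂ) : Prop :=
  Differentiable ℂ f ∧ ¬ ∃ p : Polynomial ℂ, ∀ z, f z = p.eval z

/-- The maximum modulus `M(r, f)`, the maximum of `|f z|` over the circle `|z| = r`, for `r ≥ 0`.
The supremum is attained for continuous `f`, the circle being compact and nonempty. -/
noncomputable def maxModulus (f : ℂ → ℂ) (r : ℝ) : ℝ :=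
  sSup ((fun z : ℂ => ‖f z‖) '' Metric.sphere (0 : ℂ) r)

/-- The set of points where `f` attains its maximum modulus. -/
def maxModulusSet (f : ℂ → ℂ) : Set ℂ :=
  {z | ‖f z‖ = maxModulus f ‖z‖}

/-- The fast escaping set `A(f)`. The threshold `R > 0` is any number whose iterates under
`r ↦ M(r, f)` tend to infinity; for a transcendental entire function the set defined by one such
`R` does not depend on `R`, so it agrees with the union over all `R` taken here. -/
def fastEscapingSet (f : ℂ → ℂ) : Set ℂ :=
  {z | ∃ R : ℝ, 0 < R ∧
    Filter.Tendsto (fun n : ℕ => (maxModulus f)^[n] R) Filter.atTop Filter.atTop ∧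
    ∃ l : ℕ, 1 ≤ l ∧ ∀ n : ℕ, 1 ≤ n → (maxModulus f)^[n] R ≤ ‖f^[n + l] z‖}

/-- The maximally fast escaping set `A'(f)`. -/
def maximallyFastEscapingSet (f : ℂ → ℂ) : Set ℂ :=
  {z | z ∈ fastEscapingSet f ∧
    ∃ N : ℕ, 1 ≤ N ∧ ∀ n : ℕ, N ≤ n → ‖f^[n] z‖ = maxModulus f ‖f^[n - 1] z‖}

/-- `C` is a simple curve in the plane that is analytic except possibly at its endpoints: the image
of an injective continuous map on `[0, 1]` that is real analytic with nonvanishing derivative on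
`(0, 1)`. -/
def IsCurveAnalyticOffEndpoints (C : Set ℂ) : Prop :=
  ∃ γ : ℝ → ℂ, ContinuousOn γ (Set.Icc 0 1) ∧ Set.InjOn γ (Set.Icc 0 1) ∧
    AnalyticOnNhd ℝ γ (Set.Ioo 0 1) ∧ (∀ t ∈ Set.Ioo (0 : ℝ) 1, deriv γ t ≠ 0) ∧
    C = γ '' Set.Icc 0 1

open Filter Topology

/-! If `f` attains its maximum modulus at `z`, rotating `z` cannot increase `|f|`, so `z f' / f` is
real there. Hence each preimage of the maximum modulus set under `f^[k]` lies in the real locus of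
`g = (z f' / f) ∘ f^[k]`. Where `g` is holomorphic and noncritical, this locus is locally an arc,
the image of a real segment under a local inverse of `g`; by Lindelöf countably many arcs suffice.
The remaining points are countable, and each gets a segment of its own. Countability needs `z f' /
f` nonconstant: otherwise the Euler equation `z f' = c f` would make `f` a polynomial. -/

theorem isCurveAnalyticOffEndpoints_segment (z : ℂ) :
    IsCurveAnalyticOffEndpoints ((fun t : ℝ => z + (t : ℂ)) '' Set.Icc 0 1) := by
  have hd : ∀ t : ℝ, HasDerivAt (fun t : ℝ => z + (t : ℂ)) 1 t := fun t =>
    (Complex.ofRealCLM.hasDerivAt (x := t)).const_add z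
  refine ⟨fun t : ℝ => z + (t : ℂ), ?_, ?_, ?_, ?_, rfl⟩
  · fun_prop
  · intro s _ t _ h
    simpa using h
  · intro t _
    exact analyticAt_const.add (Complex.ofRealCLM.analyticAt t)
  · intro t _
    rw [(hd t).deriv]
    exact one_ne_zero

/-- Near a point where a holomorphic `g` is real and noncritical, the set where `g` is real lies on
an analytic curve. -/
theorem AnalyticAt.exists_curve_of_deriv_ne_zero {g : ℂ → ℂ} {z : ℂ} (hg : AnalyticAt ℂ g z)
    (hg' : deriv g z ≠ 0) (hz : (g z).im = 0) :
    ∃ C : Set ℂ, IsCurveAnalyticOffEndpoints C ∧ ∀ᶠ x in 𝓝 z, (g x).im = 0 → x ∈ C := by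
  set φ := hg.hasStrictDerivAt.localInverse _ _ _ hg'
  have hφa : AnalyticAt ℂ φ (g z) := hg.analyticAt_localInverse hg'
  have hleft : ∀ᶠ x in 𝓝 z, φ (g x) = x := hg.hasStrictDerivAt.eventually_left_inverse hg'
  have hright : ∀ᶠ y in 𝓝 (g z), g (φ y) = y := hg.hasStrictDerivAt.eventually_right_inverse hg'
  have hφ' : deriv φ (g z) ≠ 0 := by
    rw [(hg.hasStrictDerivAt.to_localInverse hg').hasDerivAt.deriv]
    exact inv_ne_zero hg'
  have hnear : ∀ᶠ y in 𝓝 (g z), AnalyticAt ℂ φ y ∧ g (φ y) = y ∧ deriv φ y ≠ 0 :=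
    hφa.eventually_analyticAt.and
      (hright.and (hφa.deriv.continuousAt.eventually_ne hφ'))
  obtain ⟨r, hr, hball⟩ := Metric.eventually_nhds_iff_ball.1 hnear
  -- Halving `r` keeps the closed segment `ℓ '' [0, 1]`, endpoints included, inside the open ball.
  set ε : ℝ := r / 2 with hε
  have hε0 : 0 < ε := by positivity
  set ℓ : ℝ → ℂ := fun t => g z + ((ε * (2 * t - 1) : ℝ) : ℂ) with hℓ
  have hℓmem : ∀ t ∈ Set.Icc (0 : ℝ) 1, ℓ t ∈ Metric.ball (g z) r := by
    intro t ht
    rw [Metric.mem_ball, dist_eq_norm, hℓ]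
    simp only [add_sub_cancel_left, Complex.norm_real, Real.norm_eq_abs, abs_mul, abs_of_pos hε0]
    have : |2 * t - 1| ≤ 1 := abs_le.2 ⟨by linarith [ht.1], by linarith [ht.2]⟩
    nlinarith
  have hℓd : ∀ t, HasDerivAt ℓ ((2 * ε : ℝ) : ℂ) t := by
    intro t
    have h1 : HasDerivAt (fun t : ℝ => ε * (2 * t - 1)) (2 * ε) t := by
      have := ((((hasDerivAt_id t).const_mul 2).sub_const 1).const_mul ε)
      rwa [mul_one, mul_comm ε 2] at this
    exact h1.ofReal_comp.const_add (g z)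
  have hℓa : ∀ t, AnalyticAt ℝ ℓ t := by
    intro t
    have h1 : AnalyticAt ℝ (fun t : ℝ => ε * (2 * t - 1)) t := by fun_prop
    exact analyticAt_const.add ((Complex.ofRealCLM.analyticAt _).comp h1)
  have hℓinj : Function.Injective ℓ := by
    intro s t h
    have h' : ε * (2 * s - 1) = ε * (2 * t - 1) := by
      simpa only [hℓ, add_right_inj, Complex.ofReal_inj] using h
    have := mul_left_cancel₀ hε0.ne' h'
    linarith
  refine ⟨(φ ∘ ℓ) '' Set.Icc 0 1, ⟨φ ∘ ℓ, ?_, ?_, ?_, ?_, rfl⟩, ?_⟩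
  · intro t ht
    exact ((hball _ (hℓmem t ht)).1.continuousAt.comp (hℓa t).continuousAt).continuousWithinAt
  · intro s hs t ht h
    apply hℓinj
    rw [← (hball _ (hℓmem s hs)).2.1, ← (hball _ (hℓmem t ht)).2.1]
    exact congrArg g h
  · intro t ht
    exact ((hball _ (hℓmem t (Set.Ioo_subset_Icc_self ht))).1.restrictScalars (𝕜 := ℝ)).comp (hℓa t)
  · intro t ht
    have hb := hball _ (hℓmem t (Set.Ioo_subset_Icc_self ht))
    rw [(hb.1.differentiableAt.hasDerivAt.comp_of_eq t (hℓd t) rfl).deriv]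
    exact mul_ne_zero hb.2.2 (by exact_mod_cast (by positivity : (2 * ε) ≠ 0))
  · have hclose : ∀ᶠ x in 𝓝 z, g x ∈ Metric.ball (g z) ε :=
      hg.continuousAt (Metric.ball_mem_nhds _ hε0)
    filter_upwards [hleft, hclose] with x hx hxε hxim
    have hreal : g x = g z + (((g x).re - (g z).re : ℝ) : ℂ) := by
      apply Complex.ext <;> simp [hxim, hz]
    have habs : |(g x).re - (g z).re| < ε := by
      rw [Metric.mem_ball, dist_eq_norm] at hxε
      exact (Complex.abs_re_le_norm (g x - g z)).trans_lt hxε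
    obtain ⟨h1, h2⟩ := abs_lt.1 habs
    refine ⟨(((g x).re - (g z).re) / ε + 1) / 2, ⟨?_, ?_⟩, ?_⟩
    · have : -1 ≤ ((g x).re - (g z).re) / ε := by
        rw [le_div_iff₀ hε0]; linarith
      linarith
    · have : ((g x).re - (g z).re) / ε ≤ 1 := by
        rw [div_le_iff₀ hε0]; linarith
      linarith
    · have : ℓ ((((g x).re - (g z).re) / ε + 1) / 2) = g x := by
        refine Eq.trans ?_ hreal.symm
        simp only [hℓ, add_right_inj, Complex.ofReal_inj]
        field_simp
        ring
      rw [Function.comp_apply, this, hx]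

/-! ### Countable covers by curves -/

/-- The set `S` is contained in a countable union of curves that are analytic except possibly at
their endpoints. -/
def CoveredByCurves (S : Set ℂ) : Prop :=
  ∃ 𝒞 : Set (Set ℂ), 𝒞.Countable ∧ (∀ C ∈ 𝒞, IsCurveAnalyticOffEndpoints C) ∧ S ⊆ ⋃₀ 𝒞

theorem CoveredByCurves.mono {S T : Set ℂ} (hT : CoveredByCurves T) (h : S ⊆ T) :
    CoveredByCurves S := by
  obtain ⟨𝒞, hc, h𝒞, hT⟩ := hT
  exact ⟨𝒞, hc, h𝒞, h.trans hT⟩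

theorem CoveredByCurves.iUnion {ι : Type*} [Countable ι] {S : ι → Set ℂ}
    (hS : ∀ i, CoveredByCurves (S i)) : CoveredByCurves (⋃ i, S i) := by
  choose 𝒞 hc h𝒞 hS using hS
  refine ⟨⋃ i, 𝒞 i, Set.countable_iUnion hc, ?_, ?_⟩
  · intro C hC
    obtain ⟨i, hi⟩ := Set.mem_iUnion.1 hC
    exact h𝒞 i C hi
  · exact Set.iUnion_subset fun i =>
      (hS i).trans (Set.sUnion_subset_sUnion (Set.subset_iUnion 𝒞 i))

theorem CoveredByCurves.union {S T : Set ℂ} (hS : CoveredByCurves S) (hT : CoveredByCurves T) :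
    CoveredByCurves (S ∪ T) := by
  rw [Set.union_eq_iUnion]
  exact CoveredByCurves.iUnion fun b => by cases b <;> assumption

theorem Set.Countable.coveredByCurves {S : Set ℂ} (hS : S.Countable) : CoveredByCurves S := by
  refine ⟨(fun z : ℂ => (fun t : ℝ => z + (t : ℂ)) '' Set.Icc 0 1) '' S, hS.image _, ?_, ?_⟩
  · rintro _ ⟨z, _, rfl⟩
    exact isCurveAnalyticOffEndpoints_segment z
  · intro z hz
    exact ⟨_, ⟨z, hz, rfl⟩, 0, by simp, by simp⟩

/-- Subsets of the plane are Lindelöf, so countably many of the local curves suffice. -/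
theorem CoveredByCurves.of_locally {S : Set ℂ}
    (h : ∀ z ∈ S, ∃ C, IsCurveAnalyticOffEndpoints C ∧ C ∈ 𝓝[S] z) : CoveredByCurves S := by
  choose! c hc hcS using h
  obtain ⟨t, htS, ht, hcov⟩ := TopologicalSpace.countable_cover_nhdsWithin hcS
  refine ⟨c '' t, ht.image c, ?_, ?_⟩
  · rintro _ ⟨z, hz, rfl⟩
    exact hc z (htS hz)
  · rwa [Set.sUnion_image]

/-! ### Countability of the exceptional sets -/

theorem Differentiable.countable_zeros {g : ℂ → ℂ} (hg : Differentiable ℂ g) {a : ℂ}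
    (ha : g a ≠ 0) : {z | g z = 0}.Countable := by
  have hga : AnalyticOnNhd ℂ g Set.univ := fun z _ => hg.analyticAt z
  have hiso : ∀ z ∈ {z | g z = 0}, ({z} : Set ℂ) ∈ 𝓝[{z | g z = 0}] z := by
    intro z _
    rcases (hg.analyticAt z).eventually_eq_zero_or_eventually_ne_zero with h | h
    · exact absurd (hga.eqOn_zero_of_preconnected_of_eventuallyEq_zero isPreconnected_univ
        (Set.mem_univ z) h (Set.mem_univ a)) ha
    · rw [mem_nhdsWithin_iff_eventually]
      filter_upwards [eventually_nhdsWithin_iff.1 h] with x hx hx0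
      by_contra hne
      exact hx hne hx0
  obtain ⟨t, _, ht, hcov⟩ := TopologicalSpace.countable_cover_nhdsWithin hiso
  exact ht.mono (by simpa using hcov)

theorem Differentiable.countable_preimage {g : ℂ → ℂ} (hg : Differentiable ℂ g)
    (hne : ∀ c, ∃ a, g a ≠ c) {S : Set ℂ} (hS : S.Countable) : (g ⁻¹' S).Countable := by
  rw [← Set.biUnion_preimage_singleton]
  refine hS.biUnion fun c _ => ?_
  obtain ⟨a, ha⟩ := hne c
  refine ((hg.sub_const c).countable_zeros (a := a) (sub_ne_zero.2 ha)).mono fun z hz => ?_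
  exact sub_eq_zero.2 hz

theorem Differentiable.countable_preimage_iterate {g : ℂ → ℂ} (hg : Differentiable ℂ g)
    (hne : ∀ c, ∃ a, g a ≠ c) {S : Set ℂ} (hS : S.Countable) (k : ℕ) :
    (g^[k] ⁻¹' S).Countable := by
  induction k with
  | zero => simpa using hS
  | succ k ih =>
    rw [Function.iterate_succ, Set.preimage_comp]
    exact hg.countable_preimage hne ih

/-- By the chain rule, a critical point of `g^[k+1]` is critical for `g^[k]` or is sent by `g^[k]`
to a critical point of `g`. -/
theorem countable_critical_iterate {g : ℂ → ℂ} (hg : Differentiable ℂ g)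
    (hne : ∀ c, ∃ a, g a ≠ c) (k : ℕ) : {z | deriv (g^[k]) z = 0}.Countable := by
  have hcrit : {z | deriv g z = 0}.Countable := by
    by_cases h : ∃ a, deriv g a ≠ 0
    · obtain ⟨a, ha⟩ := h
      exact hg.deriv.countable_zeros ha
    · push Not at h
      obtain ⟨a, ha⟩ := hne (g 0)
      exact absurd (is_const_of_deriv_eq_zero hg h a 0) ha
  induction k with
  | zero => simp
  | succ k ih =>
    refine (ih.union (hg.countable_preimage_iterate hne hcrit k)).mono fun z hz => ?_
    rw [Set.mem_ofPred_eq, Function.iterate_succ',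
      deriv_comp z hg.differentiableAt (hg.iterate k).differentiableAt] at hz
    exact (mul_eq_zero.1 hz).symm

/-! ### Nonconstancy of `z f' / f` -/

/-- An entire solution of the Euler equation `z f' = c f` is a monomial. -/
theorem exists_polynomial_of_mul_deriv_eq {f : ℂ → ℂ} (hf : Differentiable ℂ f)
    {c : ℂ} (h : ∀ z, z * deriv f z = c * f z) : ∃ p : Polynomial ℂ, ∀ z, f z = p.eval z := by
  have hd : ∀ n, Differentiable ℂ (iteratedDeriv n f) := fun n =>
    (hf.contDiff (n := ⊤)).differentiable_iteratedDeriv n (by exact_mod_cast WithTop.coe_lt_top _)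
  -- The Euler equation differentiated `n` times; at `0` it kills every Taylor coefficient except
  -- possibly that of index `c`.
  have hrec : ∀ (n : ℕ) z, z * iteratedDeriv (n + 1) f z = (c - n) * iteratedDeriv n f z := by
    intro n
    induction n with
    | zero => simpa [iteratedDeriv_one] using h
    | succ n ih =>
      intro z
      have h1 : HasDerivAt (fun z => z * iteratedDeriv (n + 1) f z)
          (1 * iteratedDeriv (n + 1) f z + z * iteratedDeriv (n + 2) f z) z := by
        rw [iteratedDeriv_succ (n := n + 1)]
        exact (hasDerivAt_id z).mul (hd (n + 1) z).hasDerivAt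
      have h2 : HasDerivAt (fun z => (c - n) * iteratedDeriv n f z)
          ((c - n) * iteratedDeriv (n + 1) f z) z := by
        rw [iteratedDeriv_succ (n := n)]
        exact (hd n z).hasDerivAt.const_mul _
      have h3 := h1.unique (by simpa only [ih] using h2)
      push_cast
      linear_combination h3
  have hzero : ∀ n : ℕ, c ≠ n → iteratedDeriv n f 0 = 0 := by
    intro n hn
    have := hrec n 0
    rw [zero_mul, eq_comm] at this
    exact (mul_eq_zero.1 this).resolve_left (sub_ne_zero.2 hn)
  have htaylor := fun z => Complex.hasSum_taylorSeries_of_entire hf 0 z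
  by_cases hc : ∃ m : ℕ, c = m
  · obtain ⟨m, rfl⟩ := hc
    refine ⟨Polynomial.monomial m ((m.factorial : ℂ)⁻¹ * iteratedDeriv m f 0), fun z => ?_⟩
    have := (htaylor z).unique (hasSum_single m fun n hn => by
      rw [hzero n (by exact_mod_cast hn.symm)]; simp)
    rw [this, Polynomial.eval_monomial]
    simp only [sub_zero, smul_eq_mul]
    ring
  · push Not at hc
    refine ⟨0, fun z => ?_⟩
    have hsum := htaylor z
    simp only [hzero _ (hc _), smul_zero] at hsum
    simpa using hsum.unique hasSum_zero

/-- The numerator of the derivative of `z f' / f`. -/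
noncomputable def eulerWronskian (f : ℂ → ℂ) (z : ℂ) : ℂ :=
  (deriv f z + z * deriv (deriv f) z) * f z - z * deriv f z * deriv f z

theorem hasDerivAt_mul_deriv_div {f : ℂ → ℂ} (hf : Differentiable ℂ f) {z : ℂ}
    (hz : f z ≠ 0) :
    HasDerivAt (fun z => z * deriv f z / f z) (eulerWronskian f z / f z ^ 2) z := by
  have h := ((hasDerivAt_id z).mul (hf.deriv z).hasDerivAt).div (hf z).hasDerivAt hz
  rwa [one_mul] at h

theorem IsTranscendentalEntire.exists_ne {f : ℂ → ℂ} (hf : IsTranscendentalEntire f) (c : ℂ) :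
    ∃ a, f a ≠ c := by
  by_contra! h
  exact hf.2 ⟨Polynomial.C c, by simpa using h⟩

theorem IsTranscendentalEntire.exists_eulerWronskian_ne_zero {f : ℂ → ℂ}
    (hf : IsTranscendentalEntire f) : ∃ a, eulerWronskian f a ≠ 0 := by
  by_contra! hw
  obtain ⟨a, ha⟩ := hf.exists_ne 0
  obtain ⟨r, hr, hball⟩ :=
    Metric.eventually_nhds_iff_ball.1 (hf.1.continuous.continuousAt.eventually_ne ha)
  have hder : ∀ z ∈ Metric.ball a r, HasDerivAt (fun z => z * deriv f z / f z) 0 z := by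
    intro z hz
    simpa [hw z] using hasDerivAt_mul_deriv_div hf.1 (hball z hz)
  set c := a * deriv f a / f a
  have hconst : ∀ z ∈ Metric.ball a r, z * deriv f z / f z = c := fun z hz =>
    Metric.isOpen_ball.is_const_of_deriv_eq_zero (convex_ball a r).isPreconnected
      (fun x hx => (hder x hx).differentiableAt.differentiableWithinAt)
      (fun x hx => (hder x hx).deriv) hz (Metric.mem_ball_self hr)
  refine hf.2 (exists_polynomial_of_mul_deriv_eq hf.1 (c := c) ?_)
  -- Cleared of its denominator, the relation extends from the ball to the whole plane by the
  -- identity theorem.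
  have hev : (fun z => z * deriv f z) =ᶠ[𝓝 a] fun z => c * f z := by
    filter_upwards [Metric.ball_mem_nhds a hr] with z hz
    rw [← hconst z hz, div_mul_cancel₀ _ (hball z hz)]
  have hl : Differentiable ℂ fun z => z * deriv f z := differentiable_id.mul hf.1.deriv
  exact congrFun (AnalyticOnNhd.eq_of_eventuallyEq (fun z _ => hl.analyticAt z)
    (fun z _ => (hf.1.const_mul c).analyticAt z) hev)

/-! ### The maximum modulus set and its preimages -/

/-- At a point where `f` attains its maximum modulus, `z f' / f` is real. -/
theorem im_mul_deriv_div_eq_zero_of_mem_maxModulusSet {f : ℂ → ℂ} (hf : Differentiable ℂ f) {z : ℂ}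
    (hz : z ∈ maxModulusSet f) : (z * deriv f z / f z).im = 0 := by
  have hrot : ∀ θ : ℝ, ‖f (z * Complex.exp (θ * Complex.I))‖ ≤ ‖f z‖ := by
    intro θ
    rw [show ‖f z‖ = maxModulus f ‖z‖ from hz]
    refine le_csSup ((isCompact_sphere _ _).bddAbove_image hf.continuous.norm.continuousOn) ?_
    exact ⟨_, by simp [Complex.norm_exp_ofReal_mul_I], rfl⟩
  -- The squared norm is differentiable even at a zero of `f`, where the quotient is `0` by
  -- convention.
  have hmax : IsLocalMax (fun θ : ℝ => ‖f (z * Complex.exp (θ * Complex.I))‖ ^ 2) 0 :=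
    Eventually.of_forall fun θ => by
      simpa using pow_le_pow_left₀ (norm_nonneg _) (hrot θ) 2
  have hinner : HasDerivAt (fun θ : ℝ => z * Complex.exp (θ * Complex.I)) (z * Complex.I) 0 := by
    have h1 : HasDerivAt (fun θ : ℝ => (θ : ℂ) * Complex.I) Complex.I 0 := by
      simpa using (Complex.ofRealCLM.hasDerivAt (x := (0 : ℝ))).mul_const Complex.I
    simpa using h1.cexp.const_mul z
  have hcomp : HasDerivAt (fun θ : ℝ => f (z * Complex.exp (θ * Complex.I)))
      (deriv f z * (z * Complex.I)) 0 :=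
    (hf z).hasDerivAt.comp_of_eq 0 hinner (by simp)
  have h0 := hmax.hasDerivAt_eq_zero hcomp.norm_sq
  simp only [Complex.ofReal_zero, zero_mul, Complex.exp_zero, mul_one, Complex.inner] at h0
  have h1 : (z * deriv f z * (starRingEnd ℂ) (f z)).im = 0 := by
    simp only [Complex.mul_re, Complex.mul_im, Complex.I_re, Complex.I_im, Complex.conj_re,
      Complex.conj_im] at h0 ⊢
    linarith
  rw [Complex.div_im]
  simp only [Complex.mul_im (z * deriv f z), Complex.conj_re, Complex.conj_im] at h1
  rw [← sub_div]
  rw [div_eq_zero_iff]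
  left
  linarith

theorem IsTranscendentalEntire.coveredByCurves_preimage_maxModulusSet {f : ℂ → ℂ}
    (hf : IsTranscendentalEntire f) (k : ℕ) : CoveredByCurves (f^[k] ⁻¹' maxModulusSet f) := by
  obtain ⟨a, ha⟩ := hf.exists_ne 0
  obtain ⟨b, hb⟩ := hf.exists_eulerWronskian_ne_zero
  have hw : Differentiable ℂ (eulerWronskian f) :=
    ((hf.1.deriv.add (differentiable_id.mul hf.1.deriv.deriv)).mul hf.1).sub
      ((differentiable_id.mul hf.1.deriv).mul hf.1.deriv)
  have hbad := ((hf.1.countable_preimage_iterate hf.exists_ne (hf.1.countable_zeros ha) k).union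
    (hf.1.countable_preimage_iterate hf.exists_ne (hw.countable_zeros hb) k)).union
    (countable_critical_iterate hf.1 hf.exists_ne k)
  -- Off `B` the function `(z f' / f) ∘ f^[k]` is holomorphic with nonzero derivative.
  set B := f^[k] ⁻¹' {z | f z = 0} ∪ f^[k] ⁻¹' {z | eulerWronskian f z = 0} ∪
    {z | deriv f^[k] z = 0}
  suffices h : CoveredByCurves (f^[k] ⁻¹' maxModulusSet f \ B) from
    (hbad.coveredByCurves.union h).mono fun z hz => by
      by_cases hzB : z ∈ B
      exacts [Or.inl hzB, Or.inr ⟨hz, hzB⟩]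
  refine CoveredByCurves.of_locally fun z hz => ?_
  obtain ⟨hzM, hzB⟩ := hz
  simp only [B, Set.mem_union, Set.mem_preimage, Set.mem_ofPred_eq, not_or] at hzB
  obtain ⟨⟨hz0, hzw⟩, hzc⟩ := hzB
  have hF := (hf.1.iterate k)
  have hder : HasDerivAt ((fun z => z * deriv f z / f z) ∘ f^[k])
      (eulerWronskian f (f^[k] z) / f (f^[k] z) ^ 2 * deriv f^[k] z) z :=
    (hasDerivAt_mul_deriv_div hf.1 hz0).comp z (hF z).hasDerivAt
  have han : AnalyticAt ℂ ((fun z => z * deriv f z / f z) ∘ f^[k]) z :=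
    ((analyticAt_id.mul (hf.1.deriv.analyticAt _)).div (hf.1.analyticAt _) hz0).comp
      (hF.analyticAt z)
  obtain ⟨C, hC, hcov⟩ := han.exists_curve_of_deriv_ne_zero
    (by rw [hder.deriv]; exact mul_ne_zero (div_ne_zero hzw (pow_ne_zero 2 hz0)) hzc)
    (im_mul_deriv_div_eq_zero_of_mem_maxModulusSet hf.1 hzM)
  refine ⟨C, hC, mem_nhdsWithin_iff_eventually.2 ?_⟩
  filter_upwards [hcov] with x hx hxS
  exact hx (im_mul_deriv_div_eq_zero_of_mem_maxModulusSet hf.1 hxS.1)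

theorem maximallyFastEscapingSet_subset (f : ℂ → ℂ) :
    maximallyFastEscapingSet f ⊆ ⋃ k : ℕ, f^[k] ⁻¹' maxModulusSet f := by
  rintro z ⟨-, N, hN, h⟩
  -- `1 ≤ N` keeps the natural subtraction `n - 1` from truncating at `n = N`.
  obtain ⟨k, rfl⟩ : ∃ k, N = k + 1 := ⟨N - 1, by omega⟩
  refine Set.mem_iUnion.2 ⟨k, ?_⟩
  have := h (k + 1) le_rfl
  rwa [Function.iterate_succ_apply', Nat.add_sub_cancel] at this

theorem theorem1p1 (f : ℂ → ℂ) (hf : IsTranscendentalEntire f) :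
    (∃ 𝒞 : Set (Set ℂ), 𝒞.Countable ∧ (∀ C ∈ 𝒞, IsCurveAnalyticOffEndpoints C) ∧
      maximallyFastEscapingSet f ⊆ ⋃₀ 𝒞) ∧
    maximallyFastEscapingSet f ⊆ ⋃ k : ℕ, f^[k] ⁻¹' maxModulusSet f :=
  ⟨(CoveredByCurves.iUnion hf.coveredByCurves_preimage_maxModulusSet).mono
    (maximallyFastEscapingSet_subset f), maximallyFastEscapingSet_subset f⟩
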